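/- **Theorem 1.1.** Let $d\ge 1$ be an integer and let $\mathcal M$ be a small, projectively generated $d$-abelian category. Let $\mathcal P$ be the full subcategory of projective objects of $\mathcal M$, let $\operatorname{mod}\mathcal P$ be the category of finitely presented contravariant functors from $\mathcal P$ to abelian groups, and let $F\colon\mathcal M\to\operatorname{mod}\mathcal P$ be the functor $F(X)=\mathcal M(-,X)|_{\mathcal P}$. Then $\operatorname{mod}\mathcal P$ is an abelian category, and the essential image $$F\mathcal M=\{G\in\operatorname{mod}\mathcal P \mid \exists X\in\mathcal M:\ F(X)\cong G\}$$ is a $d$-cluster tilting subcategory of $\operatorname{mod}\mathcal P$. Here the following terminology is used. * Let $\mathcal M$ be an additive category. A *$d$-cokernel* of a morphism $f^0\colon X^0\to X^1$ is a sequence $X^1\xrightarrow{f^1}X^2\to\cdots\xrightarrow{f^d}X^{d+1}$ such that $0\to\mathcal M(X^{d+1},Z)\to\mathcal M(X^d,Z)\to\cdots\to\mathcal M(X^1,Z)\to\mathcal M(X^0,Z)$ is exact for all $Z\in\mathcal M$; a *$d$-kernel* of a morphism $X^d\to X^{d+1}$ is defined dually. A sequence $X^0\xrightarrow{f^0}\cdots\xrightarrow{f^d}X^{d+1}$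 is *$d$-exact* if $(f^0,\dots,f^{d-1})$ is a $d$-kernel of $f^d$ and $(f^1,\dots,f^d)$ is a $d$-cokernel of $f^0$. * An additive category $\mathcal M$ is *$d$-abelian* if it is idempotent complete, every morphism has a $d$-kernel and a $d$-cokernel, every monomorphism together with any $d$-cokernel of it forms a $d$-exact sequence, and every epimorphism together with any $d$-kernel of it forms a $d$-exact sequence. * An object $P$ of $\mathcal M$ is *projective* if $\mathcal M(P,X)\to\mathcal M(P,Y)$ is surjective for every epimorphism $X\to Y$; $\mathcal M$ is *projectively generated* if for every object $X$ there is an epimorphism $P\to X$ with $P$ projective. * A contravariant functor $G$ from $\mathcal P$ to abelian groups is *finitely presented* if there is an exact sequence $\mathcal P(-,P_1)\to\mathcal P(-,P_0)\to G\to 0$ with $P_0,P_1\in\mathcal P$. * A full subcategory $\mathcal T$ of an abelian category $\mathcal A$ is *$d$-cluster tilting* if it is contravariantly finite (every object has a right $\mathcal T$-approximation), covariantly finite (every object has a left $\mathcal T$-approximation), generating (every object is a quotient of an object of $\mathcal T$), cogenerating (every object is a subobject of an object of $\mathcal T$), and $$\mathcal T=\{X\in\mathcal A\mid \operatorname{Ext}^i_{\mathcal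 A}(X,\mathcal T)=0\text{ for }1\le i\le d-1\}=\{X\in\mathcal A\mid \operatorname{Ext}^i_{\mathcal A}(\mathcal T,X)=0\text{ for }1\le i\le d-1\}.$$ -/

import Mathlib

open CategoryTheory CategoryTheory.Limits Opposite

universe v u

namespace HigherAbelian

section DAbelian

variable {M : Type u} [Category.{v} M] [Preadditive M] {d : ℕ}

/-- For a sequence `X⁰ ⟶ X¹ ⟶ ⋯ ⟶ X^{d+1}` with maps `f⁰, …, f^d`, the tuple `(f¹, …, f^d)` is a
`d`-cokernel of `f⁰`: for every `Z` the sequence of abelian groups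
`0 ⟶ M(X^{d+1}, Z) ⟶ M(X^d, Z) ⟶ ⋯ ⟶ M(X¹, Z) ⟶ M(X⁰, Z)` is exact. -/
structure IsDCokernel (S : ComposableArrows M (d + 1)) : Prop where
  injective : ∀ Z : M, Function.Injective
    (fun h : S.obj' (d + 1) ⟶ Z => S.map' d (d + 1) ≫ h)
  exact : ∀ (Z : M) (i : ℕ) (hi : i < d), Function.Exact
    (fun h : S.obj' (i + 2) ⟶ Z => S.map' (i + 1) (i + 2) ≫ h)
    (fun h : S.obj' (i + 1) ⟶ Z => S.map' i (i + 1) ≫ h)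

/-- For a sequence `Y⁰ ⟶ Y¹ ⟶ ⋯ ⟶ Y^{d+1}` with maps `g⁰, …, g^d`, the tuple `(g⁰, …, g^{d-1})`
is a `d`-kernel of `g^d`: for every `Z` the sequence of abelian groups
`0 ⟶ M(Z, Y⁰) ⟶ M(Z, Y¹) ⟶ ⋯ ⟶ M(Z, Y^d) ⟶ M(Z, Y^{d+1})` is exact. -/
structure IsDKernel (S : ComposableArrows M (d + 1)) : Prop where
  injective : ∀ Z : M, Function.Injective
    (fun h : Z ⟶ S.obj' 0 => h ≫ S.map' 0 1)
  exact : ∀ (Z : M) (i : ℕ) (hi : i < d), Function.Exact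
    (fun h : Z ⟶ S.obj' i => h ≫ S.map' i (i + 1))
    (fun h : Z ⟶ S.obj' (i + 1) => h ≫ S.map' (i + 1) (i + 2))

/-- A `d`-exact sequence `X⁰ ⟶ X¹ ⟶ ⋯ ⟶ X^{d+1}`. -/
structure IsDExact (S : ComposableArrows M (d + 1)) : Prop where
  isDKernel : IsDKernel S
  isDCokernel : IsDCokernel S

/-- The category `M` is `d`-abelian. (The zero object and the binary biproducts of an additive
category are contained in `HasFiniteBiproducts`.) -/
structure IsDAbelian (d : ℕ) (M : Type u) [Category.{v} M] [Preadditive M] : Prop where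
  hasFiniteBiproducts : HasFiniteBiproducts M
  isIdempotentComplete : IsIdempotentComplete M
  exists_dKernel : ∀ {A B : M} (f : A ⟶ B), ∃ S : ComposableArrows M (d + 1),
    Arrow.mk (S.map' d (d + 1)) = Arrow.mk f ∧ IsDKernel S
  exists_dCokernel : ∀ {A B : M} (f : A ⟶ B), ∃ S : ComposableArrows M (d + 1),
    Arrow.mk (S.map' 0 1) = Arrow.mk f ∧ IsDCokernel S
  isDExact_of_mono : ∀ S : ComposableArrows M (d + 1),
    Mono (S.map' 0 1) → IsDCokernel S → IsDExact S
  isDExact_of_epi : ∀ S : ComposableArrows M (d + 1),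
    Epi (S.map' d (d + 1)) → IsDKernel S → IsDExact S

end DAbelian

section Modules

/-- Finitely presented contravariant functors `G` from `P` to abelian groups: there is a
morphism `f : P₁ ⟶ P₀` in `P` and an exact sequence `P(-, P₁) ⟶ P(-, P₀) ⟶ G ⟶ 0`.
Such a functor is automatically additive. -/
def finitelyPresented (P : Type u) [Category.{v} P] [Preadditive P] :
    ObjectProperty (Pᵒᵖ ⥤ AddCommGrpCat.{v}) := fun G =>
  ∃ (P₁ P₀ : P) (f : P₁ ⟶ P₀) (g : preadditiveYoneda.obj P₀ ⟶ G), ∀ Q : Pᵒᵖ,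
    Function.Exact ((preadditiveYoneda.map f).app Q) (g.app Q) ∧
      Function.Surjective (g.app Q)

/-- The category `mod P`, with all natural transformations as morphisms. -/
abbrev FPMod (P : Type u) [Category.{v} P] [Preadditive P] :=
  (finitelyPresented P).FullSubcategory

variable (M : Type u) [Category.{v} M] [Preadditive M]

/-- The full subcategory of projective objects of `M`. -/
abbrev Proj := (isProjective M).FullSubcategory

/-- The functor `X ↦ M(-, X)` restricted to the projective objects, with values in all
contravariant functors to abelian groups. -/
def restrictedYoneda : M ⥤ (Proj M)ᵒᵖ ⥤ AddCommGrpCat.{v} :=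
  preadditiveYoneda ⋙ (Functor.whiskeringLeft _ _ _).obj (isProjective M).ι.op

variable {M}

/-- In a projectively generated `d`-abelian category, `M(-, X)` restricted to the projective
objects is finitely presented. -/
theorem finitelyPresented_restrictedYoneda {d : ℕ} (hd : 1 ≤ d) (hM : IsDAbelian d M)
    [EnoughProjectives M] (X : M) :
    finitelyPresented (Proj M) ((restrictedYoneda M).obj X) := by
  obtain ⟨e, rfl⟩ : ∃ e, d = e + 1 := ⟨d - 1, by omega⟩
  have key : ∀ {A B : M} (f : A ⟶ B), ∃ (K : M) (k : K ⟶ A), ∀ Z : M, Function.Exact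
      (fun h : Z ⟶ K => h ≫ k) (fun h : Z ⟶ A => h ≫ f) := by
    intro A B f
    obtain ⟨S, hS, hk⟩ := hM.exists_dKernel f
    cases hS
    exact ⟨_, _, fun Z => hk.exact Z e (by omega)⟩
  obtain ⟨K, k, hk⟩ := key (Projective.π X)
  let P₁ : Proj M := ⟨Projective.over K, Projective.projective_over K⟩
  let P₀ : Proj M := ⟨Projective.over X, Projective.projective_over X⟩
  let f : P₁ ⟶ P₀ := ObjectProperty.homMk (Projective.π K ≫ k)
  let g : preadditiveYoneda.obj P₀ ⟶ (restrictedYoneda M).obj X :=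
    { app := fun Q => AddCommGrpCat.ofHom
        { toFun := fun h => ((h : Q.unop ⟶ P₀).hom ≫ Projective.π X : Q.unop.obj ⟶ X)
          map_zero' := zero_comp
          map_add' := fun _ _ => Preadditive.add_comp _ _ _ _ _ _ }
      naturality := fun _ _ q => AddCommGrpCat.ext fun h => Category.assoc _ _ _ }
  refine ⟨P₁, P₀, f, g, fun Q => ⟨fun h => ?_, fun h => ?_⟩⟩
  · have : Projective Q.unop.obj := Q.unop.property
    refine (hk Q.unop.obj (h : Q.unop ⟶ P₀).hom).trans ⟨?_, ?_⟩
    · rintro ⟨t, ht⟩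
      refine ⟨(ObjectProperty.homMk (Projective.factorThru t (Projective.π K)) :
        Q.unop ⟶ P₁), ?_⟩
      apply ObjectProperty.hom_ext
      change Projective.factorThru t (Projective.π K) ≫ Projective.π K ≫ k =
        (h : Q.unop ⟶ P₀).hom
      rw [Projective.factorThru_comp_assoc]
      exact ht
    · rintro ⟨t, ht⟩
      refine ⟨(t : Q.unop ⟶ P₁).hom ≫ Projective.π K, ?_⟩
      rw [← ht]
      exact Category.assoc _ _ _
  · have : Projective Q.unop.obj := Q.unop.property
    exact ⟨(ObjectProperty.homMk (Projective.factorThru (h : Q.unop.obj ⟶ X)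
      (Projective.π X)) : Q.unop ⟶ P₀), Projective.factorThru_comp _ _⟩

/-- The functor `F : M ⥤ mod P`, `F(X) = M(-, X)|_P`, where `P` is the category of projective
objects of the projectively generated `d`-abelian category `M`. -/
def toFPMod {d : ℕ} (hd : 1 ≤ d) (hM : IsDAbelian d M) [EnoughProjectives M] :
    M ⥤ FPMod (Proj M) :=
  (finitelyPresented (Proj M)).lift (restrictedYoneda M)
    (finitelyPresented_restrictedYoneda hd hM)

end Modules

section ClusterTilting

variable {A : Type u} [Category.{v} A]

/-- Every object of `A` has a right `T`-approximation. -/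
def IsContravariantlyFinite (T : ObjectProperty A) : Prop :=
  ∀ G : A, ∃ (X : A) (p : X ⟶ G), T X ∧
    ∀ (Y : A), T Y → ∀ ψ : Y ⟶ G, ∃ q : Y ⟶ X, q ≫ p = ψ

/-- Every object of `A` has a left `T`-approximation. -/
def IsCovariantlyFinite (T : ObjectProperty A) : Prop :=
  ∀ G : A, ∃ (X : A) (j : G ⟶ X), T X ∧
    ∀ (Y : A), T Y → ∀ ψ : G ⟶ Y, ∃ q : X ⟶ Y, j ≫ q = ψ

/-- Every object of `A` is a quotient of an object of `T`. -/
def IsGenerating (T : ObjectProperty A) : Prop :=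
  ∀ G : A, ∃ (X : A) (p : X ⟶ G), T X ∧ Epi p

/-- Every object of `A` is a subobject of an object of `T`. -/
def IsCogenerating (T : ObjectProperty A) : Prop :=
  ∀ G : A, ∃ (X : A) (j : G ⟶ X), T X ∧ Mono j

variable [Abelian A]

/-- `Extⁱ_A(X, Y) = 0`. -/
def ExtVanishes (X Y : A) (i : ℕ) : Prop :=
  haveI : HasExt.{max u v} A := HasExt.standard A
  Subsingleton (Abelian.Ext.{max u v} X Y i)

/-- The full subcategory of the abelian category `A` on the objects satisfying `T` is
`d`-cluster tilting. -/
structure IsClusterTilting (d : ℕ) (T : ObjectProperty A) : Prop where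
  isContravariantlyFinite : IsContravariantlyFinite T
  isCovariantlyFinite : IsCovariantlyFinite T
  isGenerating : IsGenerating T
  isCogenerating : IsCogenerating T
  iff_ext_left : ∀ X : A, T X ↔
    ∀ i : ℕ, 1 ≤ i → i < d → ∀ Y : A, T Y → ExtVanishes X Y i
  iff_ext_right : ∀ X : A, T X ↔
    ∀ i : ℕ, 1 ≤ i → i < d → ∀ Y : A, T Y → ExtVanishes Y X i

end ClusterTilting

end HigherAbelian

/-!
Let `T` be the essential image of `F`. The functor `F` is fully faithful and turns `d`-kernels into
exact sequences. Hence the kernel of a morphism between objects of `T` has a resolution by `d`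
objects of `T`, and, since a monomorphism with its `d`-cokernel is `d`-exact, the cokernel of a
monomorphism between objects of `T` has a coresolution by `d` objects of `T`.

For the vanishing of `Extⁱ(F X, F Y)`, apply `F` to the `d`-kernel of an epimorphism `P ⟶ X` with
`P` projective. The `d`-cokernel property says that `Hom(-, F Y)` is exact on the resulting exact
sequence; as `F P` is projective, dimension shifting along it reduces the claim to smaller `i`.

Every object of `mod P` is the cokernel of a morphism between objects of `T`, hence has a finite
resolution by objects of `T`. By the vanishing of `Ext`, morphisms to objects of `T` extend along
monomorphisms whose cokernel has a short coresolution, and a horseshoe argument turns a finite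
resolution into a coresolution by `d` objects of `T`, one kernel at a time. Consequently every
object `G` is also the kernel of a morphism between objects of `T`, so it has a resolution by `d`
objects of `T`. If `G` is `Ext`-orthogonal to `T` on one side, the identity of `G` lifts or extends
along the first map of its (co)resolution, so `G` is a retract of an object of `T`, and lies in `T`
because idempotents split in `M`.
-/

universe w v' u'

namespace HigherAbelian

section Resolutions

variable {A : Type u} [Category.{v} A] [Abelian A] {T : ObjectProperty A}

/-- `G` has a coresolution `0 ⟶ G ⟶ Z₁ ⟶ ⋯ ⟶ Zₙ ⟶ 0` by `n` objects satisfying `T`, given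
through its successive cokernels. -/
def HasCoresolution (T : ObjectProperty A) : ℕ → A → Prop
  | 0, G => IsZero G
  | n + 1, G => ∃ (Z : A) (j : G ⟶ Z), Mono j ∧ T Z ∧ HasCoresolution T n (cokernel j)

/-- `G` has a resolution `0 ⟶ Zₙ ⟶ ⋯ ⟶ Z₁ ⟶ G ⟶ 0` by `n` objects satisfying `T`, given
through its successive kernels. -/
def HasResolution (T : ObjectProperty A) : ℕ → A → Prop
  | 0, G => IsZero G
  | n + 1, G => ∃ (Z : A) (p : Z ⟶ G), Epi p ∧ T Z ∧ HasResolution T n (kernel p)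

theorem shortExact_kernel {X Y : A} (f : X ⟶ Y) [Epi f] :
    (ShortComplex.mk (kernel.ι f) f (kernel.condition f)).ShortExact :=
  .mk' (ShortComplex.exact_of_f_is_kernel _ (kernelIsKernel f)) inferInstance ‹_›

theorem shortExact_cokernel {X Y : A} (f : X ⟶ Y) [Mono f] :
    (ShortComplex.mk f (cokernel.π f) (cokernel.condition f)).ShortExact :=
  .mk' (ShortComplex.exact_of_g_is_cokernel _ (cokernelIsCokernel f)) ‹_› inferInstance

theorem HasCoresolution.of_iso {n : ℕ} {G H : A} (h : HasCoresolution T n G) (e : G ≅ H) :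
    HasCoresolution T n H := by
  induction n generalizing G H with
  | zero => exact IsZero.of_iso h e.symm
  | succ n ih =>
    obtain ⟨Z, j, _, hZ, hj⟩ := h
    exact ⟨Z, e.inv ≫ j, inferInstance, hZ, ih hj (cokernelEpiComp e.inv j).symm⟩

theorem HasResolution.of_iso {n : ℕ} {G H : A} (h : HasResolution T n G) (e : G ≅ H) :
    HasResolution T n H := by
  induction n generalizing G H with
  | zero => exact IsZero.of_iso h e.symm
  | succ n ih =>
    obtain ⟨Z, p, _, hZ, hp⟩ := h
    exact ⟨Z, p ≫ e.hom, inferInstance, hZ, ih hp (kernelCompMono p e.hom).symm⟩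

theorem HasCoresolution.succ [T.ContainsZero] {n : ℕ} {G : A} (h : HasCoresolution T n G) :
    HasCoresolution T (n + 1) G := by
  induction n generalizing G with
  | zero =>
    obtain ⟨Z, hZ, hTZ⟩ := T.exists_prop_of_containsZero
    exact ⟨Z, 0, ⟨fun _ _ _ => h.eq_of_tgt _ _⟩, hTZ,
      hZ.of_iso (cokernelZeroIsoTarget (X := G) (Y := Z))⟩
  | succ n ih =>
    obtain ⟨Z, j, hj, hZ, hC⟩ := h
    exact ⟨Z, j, hj, hZ, ih hC⟩

theorem HasCoresolution.of_isZero [T.ContainsZero] {G : A} (h : IsZero G) (n : ℕ) :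
    HasCoresolution T n G := by
  induction n with
  | zero => exact h
  | succ n ih => exact ih.succ

theorem HasResolution.X₃_of_prop_X₂ {S : ShortComplex A} (hS : S.ShortExact) (h₂ : T S.X₂)
    {n : ℕ} (h₁ : HasResolution T n S.X₁) : HasResolution T (n + 1) S.X₃ :=
  ⟨S.X₂, S.g, hS.epi_g, h₂,
    h₁.of_iso (hS.fIsKernel.conePointUniqueUpToIso (limit.isLimit _))⟩

theorem HasCoresolution.X₁_of_prop_X₂ {S : ShortComplex A} (hS : S.ShortExact) (h₂ : T S.X₂)
    {n : ℕ} (h₃ : HasCoresolution T n S.X₃) : HasCoresolution T (n + 1) S.X₁ :=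
  ⟨S.X₂, S.f, hS.mono_f, h₂,
    h₃.of_iso (hS.gIsCokernel.coconePointUniqueUpToIso (colimit.isColimit _))⟩

theorem shortExact_cokernel_hom {S₁ S₂ : ShortComplex A} (φ : S₁ ⟶ S₂) (h₁ : S₁.ShortExact)
    (h₂ : S₂.ShortExact) [Mono φ.τ₃] : (cokernel φ).ShortExact := by
  let I : ShortComplex.SnakeInput A :=
    { L₀ := kernel φ
      L₁ := S₁
      L₂ := S₂
      L₃ := cokernel φ
      v₀₁ := kernel.ι φ
      v₁₂ := φ
      v₂₃ := cokernel.π φ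
      w₀₂ := kernel.condition φ
      w₁₃ := cokernel.condition φ
      h₀ := kernelIsKernel φ
      h₃ := cokernelIsCokernel φ
      L₁_exact := h₁.exact
      epi_L₁_g := h₁.epi_g
      L₂_exact := h₂.exact
      mono_L₂_f := h₂.mono_f }
  have hδ : I.δ = 0 :=
    ((isZero_kernel_of_mono φ.τ₃).of_iso
      (PreservesKernel.iso ShortComplex.π₃ φ)).eq_of_src _ _
  have : Epi I.L₂.g := h₂.epi_g
  exact .mk' I.L₃_exact (I.L₂'_exact.mono_g hδ) I.epi_L₃_g

theorem shortExact_cokernelMap {S₁ S₂ : ShortComplex A} (φ : S₁ ⟶ S₂) (h₁ : S₁.ShortExact)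
    (h₂ : S₂.ShortExact) [Mono φ.τ₃] :
    (ShortComplex.mk (cokernel.map φ.τ₁ φ.τ₂ S₁.f S₂.f φ.comm₁₂)
      (cokernel.map φ.τ₂ φ.τ₃ S₁.g S₂.g φ.comm₂₃) (by ext; simp)).ShortExact := by
  obtain ⟨e₁, he₁⟩ : ∃ e : (cokernel φ).X₁ ≅ cokernel φ.τ₁,
      (cokernel.π φ).τ₁ ≫ e.hom = cokernel.π φ.τ₁ :=
    ⟨PreservesCokernel.iso ShortComplex.π₁ φ, PreservesCokernel.π_iso_hom ShortComplex.π₁ φ⟩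
  obtain ⟨e₂, he₂⟩ : ∃ e : (cokernel φ).X₂ ≅ cokernel φ.τ₂,
      (cokernel.π φ).τ₂ ≫ e.hom = cokernel.π φ.τ₂ :=
    ⟨PreservesCokernel.iso ShortComplex.π₂ φ, PreservesCokernel.π_iso_hom ShortComplex.π₂ φ⟩
  obtain ⟨e₃, he₃⟩ : ∃ e : (cokernel φ).X₃ ≅ cokernel φ.τ₃,
      (cokernel.π φ).τ₃ ≫ e.hom = cokernel.π φ.τ₃ :=
    ⟨PreservesCokernel.iso ShortComplex.π₃ φ, PreservesCokernel.π_iso_hom ShortComplex.π₃ φ⟩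
  have : Epi (cokernel.π φ).τ₁ := inferInstanceAs (Epi (ShortComplex.π₁.map (cokernel.π φ)))
  have : Epi (cokernel.π φ).τ₂ := inferInstanceAs (Epi (ShortComplex.π₂.map (cokernel.π φ)))
  refine ShortComplex.shortExact_of_iso (ShortComplex.isoMk e₁ e₂ e₃ ?_ ?_)
    (shortExact_cokernel_hom φ h₁ h₂)
  · rw [← cancel_epi (cokernel.π φ).τ₁, reassoc_of% he₁, reassoc_of% (cokernel.π φ).comm₁₂, he₂]
    exact cokernel.π_desc ..
  · rw [← cancel_epi (cokernel.π φ).τ₂, reassoc_of% he₂, reassoc_of% (cokernel.π φ).comm₂₃, he₃]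
    exact cokernel.π_desc ..

theorem mono_and_shortExact_cokernel_biprodLift {S : ShortComplex A} (hS : S.ShortExact) {V U : A}
    (a : S.X₂ ⟶ V) (b : S.X₃ ⟶ U) [Mono (S.f ≫ a)] [Mono b] :
    Mono (biprod.lift a (S.g ≫ b)) ∧
    (ShortComplex.mk (cokernel.map (S.f ≫ a) (biprod.lift a (S.g ≫ b)) S.f biprod.inl
        (by ext <;> simp))
      (cokernel.map (biprod.lift a (S.g ≫ b)) b S.g biprod.snd (by simp))
      (by ext; simp)).ShortExact := by
  let φ : S ⟶ ShortComplex.mk (biprod.inl : V ⟶ V ⊞ U) biprod.snd (by simp) :=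
    { τ₁ := S.f ≫ a
      τ₂ := biprod.lift a (S.g ≫ b)
      τ₃ := b
      comm₁₂ := by ext <;> simp }
  have hφ := (ShortComplex.Splitting.ofHasBinaryBiproduct V U).shortExact
  have : Mono φ.τ₁ := ‹_›
  have : Mono φ.τ₃ := ‹_›
  have := hS.mono_f
  exact ⟨ShortComplex.mono_τ₂_of_exact_of_mono φ hS.exact, shortExact_cokernelMap φ hS hφ⟩

theorem shortExact_cokernel_comp {X Y Z : A} (i : X ⟶ Y) (j : Y ⟶ Z) [Mono j] :
    (ShortComplex.mk (cokernel.map i (i ≫ j) (𝟙 X) j (by simp))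
      (cokernel.map (i ≫ j) j i (𝟙 Z) (by simp)) (by ext; simp)).ShortExact := by
  have hS := kernelCokernelCompSequence_exact i j
  refine .mk' (hS.exact 3) ?_ ?_
  · exact (hS.exact 2).mono_g ((isZero_kernel_of_mono j).eq_of_src _ _)
  · exact epi_of_epi_fac (cokernel.π_desc ..)

/-- Morphisms to objects satisfying `T` extend along every monomorphism whose cokernel has a
coresolution by `n` objects satisfying `T`. -/
def ExtendsAlong (T : ObjectProperty A) (n : ℕ) : Prop :=
  ∀ ⦃S : ShortComplex A⦄, S.ShortExact → HasCoresolution T n S.X₃ →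
    ∀ ⦃Y : A⦄, T Y → ∀ f : S.X₁ ⟶ Y, ∃ g : S.X₂ ⟶ Y, S.f ≫ g = f

theorem ExtendsAlong.of_succ [T.ContainsZero] {n : ℕ} (h : ExtendsAlong T (n + 1)) :
    ExtendsAlong T n :=
  fun _ hS hn => h hS hn.succ

theorem HasCoresolution.X₂_of_shortExact [T.ContainsZero]
    (hsum : ∀ X Y, T X → T Y → T (X ⊞ Y)) {n : ℕ} (hext : ExtendsAlong T n)
    {S : ShortComplex A} (hS : S.ShortExact) (h₁ : HasCoresolution T n S.X₁)
    (h₃ : HasCoresolution T n S.X₃) : HasCoresolution T n S.X₂ := by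
  induction n generalizing S with
  | zero => exact hS.exact.isZero_of_both_zeros (h₁.eq_of_src _ _) (h₃.eq_of_tgt _ _)
  | succ n ih =>
    obtain ⟨V, a, _, hV, ha⟩ := id h₁
    obtain ⟨U, b, _, hU, hb⟩ := id h₃
    obtain ⟨a, rfl⟩ := hext hS h₃ hV a
    obtain ⟨hm, hS'⟩ := mono_and_shortExact_cokernel_biprodLift hS a b
    exact ⟨V ⊞ U, _, hm, hsum _ _ hV hU, ih hext.of_succ hS' ha hb⟩

theorem HasCoresolution.X₁_of_shortExact [T.ContainsZero]
    (hsum : ∀ X Y, T X → T Y → T (X ⊞ Y)) {n : ℕ} (hext : ExtendsAlong T n)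
    {S : ShortComplex A} (hS : S.ShortExact) (h₂ : HasCoresolution T (n + 1) S.X₂)
    (h₃ : HasCoresolution T n S.X₃) : HasCoresolution T (n + 1) S.X₁ := by
  obtain ⟨W, j, _, hW, hj⟩ := h₂
  have := hS.mono_f
  exact ⟨W, S.f ≫ j, inferInstance, hW,
    .X₂_of_shortExact hsum hext (shortExact_cokernel_comp S.f j)
      (h₃.of_iso (hS.gIsCokernel.coconePointUniqueUpToIso (colimit.isColimit _))) hj⟩

theorem HasResolution.hasCoresolution [T.ContainsZero]
    (hsum : ∀ X Y, T X → T Y → T (X ⊞ Y)) {e : ℕ} (hext : ExtendsAlong T e)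
    (hmono : ∀ ⦃X Y : A⦄ (f : X ⟶ Y) [Mono f], T X → T Y →
      HasCoresolution T (e + 1) (cokernel f))
    {n : ℕ} {G : A} (hG : HasResolution T n G) : HasCoresolution T (e + 1) G := by
  induction n generalizing G with
  | zero => exact .of_isZero hG _
  | succ n ih =>
    obtain ⟨Z, p, _, hZ, hp⟩ := hG
    obtain ⟨W, i, _, hW, hi⟩ := ih hp
    obtain ⟨U, b, _, hU, hb⟩ := hi.succ
    obtain ⟨a, ha⟩ := hext (shortExact_cokernel i) hi hZ (kernel.ι p)
    have : Mono ((ShortComplex.mk i (cokernel.π i) (cokernel.condition i)).f ≫ a) := by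
      rw [ha]; infer_instance
    obtain ⟨_, hS⟩ := mono_and_shortExact_cokernel_biprodLift (shortExact_cokernel i) a b
    refine (HasCoresolution.X₁_of_shortExact hsum hext hS (hmono _ hW (hsum _ _ hZ hU)) hb).of_iso
      (cokernelIsoOfEq ha ≪≫ ?_)
    exact (colimit.isColimit _).coconePointUniqueUpToIso (shortExact_kernel p).gIsCokernel

end Resolutions

section Ext

open Abelian

variable {A : Type u} [Category.{v} A] [Abelian A]

section DimensionShifting

variable [HasExt.{w} A] {S : ShortComplex A} (hS : S.ShortExact)

include hS

theorem subsingleton_ext_X₁_left {Y : A} {i : ℕ} (h₂ : Subsingleton (Ext.{w} S.X₂ Y i))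
    (h₃ : Subsingleton (Ext.{w} S.X₃ Y (i + 1))) : Subsingleton (Ext.{w} S.X₁ Y i) :=
  subsingleton_of_forall_eq 0 fun x => by
    obtain ⟨y, rfl⟩ := Ext.contravariant_sequence_exact₁ hS Y x (n₁ := i + 1) (by omega)
      (Subsingleton.elim _ _)
    rw [Subsingleton.elim y 0, Ext.comp_zero]

theorem subsingleton_ext_X₃_left {Y : A} {i : ℕ} (h₁ : Subsingleton (Ext.{w} S.X₁ Y i))
    (h₂ : Subsingleton (Ext.{w} S.X₂ Y (i + 1))) : Subsingleton (Ext.{w} S.X₃ Y (i + 1)) :=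
  subsingleton_of_forall_eq 0 fun x => by
    obtain ⟨y, rfl⟩ := Ext.contravariant_sequence_exact₃ hS Y x (Subsingleton.elim _ _)
      (n₀ := i) (by omega)
    rw [Subsingleton.elim y 0, Ext.comp_zero]

theorem subsingleton_ext_X₃_right {X : A} {i : ℕ} (h₂ : Subsingleton (Ext.{w} X S.X₂ i))
    (h₁ : Subsingleton (Ext.{w} X S.X₁ (i + 1))) : Subsingleton (Ext.{w} X S.X₃ i) :=
  subsingleton_of_forall_eq 0 fun x => by
    obtain ⟨y, rfl⟩ := Ext.covariant_sequence_exact₃ X hS x (n₁ := i + 1) rfl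
      (Subsingleton.elim _ _)
    rw [Subsingleton.elim y 0, Ext.zero_comp]

theorem subsingleton_ext_one_X₃_left {Y : A} (h₁ : ∀ f : S.X₁ ⟶ Y, ∃ g : S.X₂ ⟶ Y, S.f ≫ g = f)
    (h₂ : Subsingleton (Ext.{w} S.X₂ Y 1)) : Subsingleton (Ext.{w} S.X₃ Y 1) :=
  subsingleton_of_forall_eq 0 fun x => by
    obtain ⟨y, rfl⟩ := Ext.contravariant_sequence_exact₃ hS Y x (Subsingleton.elim _ _)
      (n₀ := 0) rfl
    obtain ⟨f, rfl⟩ := Ext.homEquiv₀.symm.surjective y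
    obtain ⟨g, rfl⟩ := h₁ f
    change hS.extClass.comp (Ext.mk₀ (S.f ≫ g)) _ = 0
    rw [← Ext.mk₀_comp_mk₀, ← Ext.comp_assoc _ _ _ (add_zero 1) (zero_add 0) (by simp),
      hS.extClass_comp, Ext.zero_comp]

theorem exists_extension_of_subsingleton_ext {Y : A} (h : Subsingleton (Ext.{w} S.X₃ Y 1))
    (f : S.X₁ ⟶ Y) : ∃ g : S.X₂ ⟶ Y, S.f ≫ g = f := by
  obtain ⟨y, hy⟩ := Ext.contravariant_sequence_exact₁ hS Y (Ext.mk₀ f) (n₁ := 1) rfl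
    (Subsingleton.elim _ _)
  obtain ⟨g, rfl⟩ := Ext.homEquiv₀.symm.surjective y
  exact ⟨g, Ext.mk₀_bijective _ _ |>.1 ((Ext.mk₀_comp_mk₀ _ _).symm.trans hy)⟩

theorem exists_lift_of_subsingleton_ext {X : A} (h : Subsingleton (Ext.{w} X S.X₁ 1))
    (f : X ⟶ S.X₃) : ∃ g : X ⟶ S.X₂, g ≫ S.g = f := by
  obtain ⟨y, hy⟩ := Ext.covariant_sequence_exact₃ X hS (Ext.mk₀ f) (n₁ := 1) rfl
    (Subsingleton.elim _ _)
  obtain ⟨g, rfl⟩ := Ext.homEquiv₀.symm.surjective y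
  exact ⟨g, Ext.mk₀_bijective _ _ |>.1 ((Ext.mk₀_comp_mk₀ _ _).symm.trans hy)⟩

end DimensionShifting

section Orthogonality

variable [HasExt.{w} A]

theorem subsingleton_ext_of_isZero_left {X : A} (h : IsZero X) (Y : A) (i : ℕ) :
    Subsingleton (Ext.{w} X Y i) :=
  subsingleton_of_forall_eq 0 fun x => by
    rw [← Ext.mk₀_id_comp x, h.eq_of_src (𝟙 X) 0, Ext.mk₀_zero, Ext.zero_comp]

theorem subsingleton_ext_of_isZero_right {Y : A} (h : IsZero Y) (X : A) (i : ℕ) :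
    Subsingleton (Ext.{w} X Y i) :=
  subsingleton_of_forall_eq 0 fun x => by
    rw [← Ext.comp_mk₀_id x, h.eq_of_src (𝟙 Y) 0, Ext.mk₀_zero, Ext.comp_zero]

theorem subsingleton_ext_of_iso {X X' : A} (e : X ≅ X') {Y : A} {i : ℕ}
    (h : Subsingleton (Ext.{w} X Y i)) : Subsingleton (Ext.{w} X' Y i) :=
  subsingleton_of_forall_eq 0 fun x => by
    have : (Ext.mk₀ e.inv).comp ((Ext.mk₀ e.hom).comp x (zero_add i)) (zero_add i) = x := by simp
    rw [← this, Subsingleton.elim ((Ext.mk₀ e.hom).comp x _) 0, Ext.comp_zero]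

/-- The objects `X` with `Extⁱ(X, T) = 0` for `1 ≤ i ≤ d - 1`. -/
def leftExtOrthogonal (d : ℕ) (T : ObjectProperty A) : ObjectProperty A := fun X =>
  ∀ i : ℕ, 1 ≤ i → i < d → ∀ Y : A, T Y → Subsingleton (Ext.{w} X Y i)

/-- The objects `X` with `Extⁱ(T, X) = 0` for `1 ≤ i ≤ d - 1`. -/
def rightExtOrthogonal (d : ℕ) (T : ObjectProperty A) : ObjectProperty A := fun X =>
  ∀ i : ℕ, 1 ≤ i → i < d → ∀ Y : A, T Y → Subsingleton (Ext.{w} Y X i)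

variable {T : ObjectProperty A} {d : ℕ}

theorem le_rightExtOrthogonal_iff :
    T ≤ rightExtOrthogonal d T ↔ T ≤ leftExtOrthogonal d T :=
  ⟨fun h X hX i hi hid Y hY => h Y hY i hi hid X hX,
    fun h X hX i hi hid Y hY => h Y hY i hi hid X hX⟩

theorem HasCoresolution.subsingleton_ext {Y : A} (hY : rightExtOrthogonal d T Y) {n : ℕ}
    {C : A} (hC : HasCoresolution T n C) {i : ℕ} (hi : 1 ≤ i) (hin : i + n ≤ d) :
    Subsingleton (Ext.{w} C Y i) := by
  induction n generalizing C i with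
  | zero => exact subsingleton_ext_of_isZero_left hC Y i
  | succ n ih =>
    obtain ⟨Z, j, _, hZ, hj⟩ := hC
    exact subsingleton_ext_X₁_left (shortExact_cokernel j) (hY i hi (by omega) Z hZ)
      (ih hj (by omega) (by omega))

theorem HasResolution.subsingleton_ext {X : A} (hX : leftExtOrthogonal d T X) {n : ℕ}
    {K : A} (hK : HasResolution T n K) {i : ℕ} (hi : 1 ≤ i) (hin : i + n ≤ d) :
    Subsingleton (Ext.{w} X K i) := by
  induction n generalizing K i with
  | zero => exact subsingleton_ext_of_isZero_right hK X i
  | succ n ih =>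
    obtain ⟨Z, p, _, hZ, hp⟩ := hK
    exact subsingleton_ext_X₃_right (shortExact_kernel p) (hX i hi (by omega) Z hZ)
      (ih hp (by omega) (by omega))

variable {e : ℕ}

theorem extendsAlong_of_le_rightExtOrthogonal (hT : T ≤ rightExtOrthogonal (e + 1) T) :
    ExtendsAlong T e := fun _ hS hn _ hY =>
  exists_extension_of_subsingleton_ext hS (hn.subsingleton_ext (hT _ hY) le_rfl (by omega))

theorem HasResolution.prop_of_leftExtOrthogonal [T.IsStableUnderRetracts] {X : A}
    (hX : HasResolution T (e + 1) X) (h : leftExtOrthogonal (e + 1) T X) : T X := by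
  obtain ⟨Z, p, _, hZ, hp⟩ := hX
  obtain ⟨s, hs⟩ := exists_lift_of_subsingleton_ext (shortExact_kernel p)
    (hp.subsingleton_ext h le_rfl (by omega)) (𝟙 X)
  exact T.prop_of_retract ⟨s, p, hs⟩ hZ

theorem HasCoresolution.prop_of_rightExtOrthogonal [T.IsStableUnderRetracts] {X : A}
    (hX : HasCoresolution T (e + 1) X) (h : rightExtOrthogonal (e + 1) T X) : T X := by
  obtain ⟨Z, j, _, hZ, hj⟩ := hX
  obtain ⟨r, hr⟩ := exists_extension_of_subsingleton_ext (shortExact_cokernel j)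
    (hj.subsingleton_ext h le_rfl (by omega)) (𝟙 X)
  exact T.prop_of_retract ⟨j, r, hr⟩ hZ

end Orthogonality

section ClusterTilting

variable {T : ObjectProperty A}

theorem isClusterTilting_of_forall_hasResolution [HasExt.{max u v} A] [T.IsStableUnderRetracts]
    {e : ℕ} (hT : T ≤ leftExtOrthogonal (e + 1) T)
    (hres : ∀ G : A, HasResolution T (e + 1) G)
    (hcores : ∀ G : A, HasCoresolution T (e + 1) G) : IsClusterTilting (e + 1) T where
  isContravariantlyFinite G := by
    obtain ⟨Z, p, _, hZ, hp⟩ := hres G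
    exact ⟨Z, p, hZ, fun Y hY => exists_lift_of_subsingleton_ext (shortExact_kernel p)
      (hp.subsingleton_ext (hT _ hY) le_rfl (by omega))⟩
  isCovariantlyFinite G := by
    obtain ⟨Z, j, _, hZ, hj⟩ := hcores G
    exact ⟨Z, j, hZ, fun Y hY => extendsAlong_of_le_rightExtOrthogonal
      (le_rightExtOrthogonal_iff.2 hT) (shortExact_cokernel j) hj hY⟩
  isGenerating G := by
    obtain ⟨Z, p, hp, hZ, -⟩ := hres G
    exact ⟨Z, p, hZ, hp⟩
  isCogenerating G := by
    obtain ⟨Z, j, hj, hZ, -⟩ := hcores G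
    exact ⟨Z, j, hZ, hj⟩
  iff_ext_left X := ⟨hT X, (hres X).prop_of_leftExtOrthogonal⟩
  iff_ext_right X :=
    ⟨le_rightExtOrthogonal_iff.2 hT X, (hcores X).prop_of_rightExtOrthogonal⟩

theorem HasResolution.cokernel {X Y : A} {f : X ⟶ Y} (hX : T X) (hY : T Y) {n : ℕ}
    (hf : HasResolution T n (kernel f)) : HasResolution T (n + 2) (cokernel f) :=
  ⟨Y, cokernel.π f, inferInstance, hY, X, Abelian.factorThruImage f, inferInstance, hX,
    hf.of_iso (kernelIsoOfEq (Abelian.image.fac f).symm ≪≫ kernelCompMono _ _)⟩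

theorem isClusterTilting_of_le_leftExtOrthogonal [T.IsStableUnderRetracts] [T.ContainsZero]
    (hsum : ∀ X Y, T X → T Y → T (X ⊞ Y)) {d : ℕ} (hd : 1 ≤ d)
    (hT : haveI := HasExt.standard A; T ≤ leftExtOrthogonal d T)
    (hker : ∀ ⦃X Y : A⦄ (f : X ⟶ Y), T X → T Y → HasResolution T d (kernel f))
    (hmono : ∀ ⦃X Y : A⦄ (f : X ⟶ Y) [Mono f], T X → T Y → HasCoresolution T d (cokernel f))
    (hpres : ∀ G : A, ∃ (X Y : A) (f : X ⟶ Y), T X ∧ T Y ∧ Nonempty (cokernel f ≅ G)) :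
    IsClusterTilting d T := by
  have := HasExt.standard A
  obtain ⟨e, rfl⟩ : ∃ e, d = e + 1 := ⟨d - 1, by omega⟩
  have hcores : ∀ G : A, HasCoresolution T (e + 1) G := fun G => by
    obtain ⟨X, Y, f, hX, hY, ⟨i⟩⟩ := hpres G
    exact ((hker f hX hY).cokernel hX hY).hasCoresolution hsum
      (extendsAlong_of_le_rightExtOrthogonal (le_rightExtOrthogonal_iff.2 hT)) hmono |>.of_iso i
  refine isClusterTilting_of_forall_hasResolution hT (fun G => ?_) hcores
  obtain ⟨Z₁, j, _, hZ₁, -⟩ := hcores G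
  obtain ⟨Z₂, k, _, hZ₂, -⟩ := hcores (Limits.cokernel j)
  exact (hker (cokernel.π j ≫ k) hZ₁ hZ₂).of_iso (kernelCompMono _ _ ≪≫
    (limit.isLimit _).conePointUniqueUpToIso (shortExact_cokernel j).fIsKernel)

end ClusterTilting

end Ext

section ExactSequences

open Abelian

variable {A : Type u} [Category.{v} A] [Abelian A]

theorem shortExact_kernel_lift {S : ShortComplex A} (hS : S.Exact) :
    (ShortComplex.mk (kernel.ι S.f) (kernel.lift S.g S.f S.zero)
      (by rw [← cancel_mono (kernel.ι S.g)]; simp)).ShortExact :=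
  .mk' (ShortComplex.exact_of_f_is_kernel _
      (isKernelOfComp (kernel.ι S.g) S.f (kernelIsKernel S.f) _ (kernel.lift_ι _ _ _)))
    inferInstance hS.epi_kernelLift

theorem shortExact_cokernel_desc {S : ShortComplex A} (hS : S.Exact) :
    (ShortComplex.mk (cokernel.desc S.f S.g S.zero) (cokernel.π S.g)
      (by rw [← cancel_epi (cokernel.π S.f)]; simp)).ShortExact :=
  .mk' (ShortComplex.exact_of_g_is_cokernel _
      (isCokernelOfComp (cokernel.π S.f) S.g (cokernelIsCokernel S.g) _ (cokernel.π_desc _ _ _)))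
    hS.mono_cokernelDesc inferInstance

variable {T : ObjectProperty A} {d : ℕ} {S : ComposableArrows A (d + 1)}

theorem hasResolution_kernel (hS : S.Exact) [Mono (S.map' 0 1)]
    (hT : ∀ i (hi : i ≤ d + 1), T (S.obj' i)) (i : ℕ) (hi : i ≤ d) :
    HasResolution T i (kernel (S.map' i (i + 1))) := by
  induction i with
  | zero => exact isZero_kernel_of_mono _
  | succ i ih =>
    exact .X₃_of_prop_X₂ (shortExact_kernel_lift (hS.exact i)) (hT i (by omega)) (ih (by omega))

theorem hasCoresolution_cokernel (hS : S.Exact) [Epi (S.map' d (d + 1))]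
    (hT : ∀ i (hi : i ≤ d + 1), T (S.obj' i)) (n i : ℕ) (hi : i + n = d) :
    HasCoresolution T n (cokernel (S.map' i (i + 1))) := by
  induction n generalizing i with
  | zero =>
    obtain rfl : i = d := by omega
    exact isZero_cokernel_of_epi _
  | succ n ih =>
    exact .X₁_of_prop_X₂ (shortExact_cokernel_desc (hS.exact i)) (hT (i + 2) (by omega))
      (ih (i + 1) (by omega))

theorem subsingleton_ext_cokernel [HasExt.{w} A] (hS : S.Exact) {Y : A}
    (hY : ∀ i (hi : i < d) (h : S.obj' (i + 1) ⟶ Y), S.map' i (i + 1) ≫ h = 0 →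
      ∃ h' : S.obj' (i + 2) ⟶ Y, S.map' (i + 1) (i + 2) ≫ h' = h)
    {n : ℕ} (hExt : ∀ i (hi : i ≤ d) k, k < n → Subsingleton (Ext.{w} (S.obj' i) Y (k + 1)))
    (j : ℕ) (hn : n ≤ j) (hj : j + 1 < d + 1)
    (hj' : Subsingleton (Ext.{w} (S.obj' (j + 2)) Y (n + 1))) :
    Subsingleton (Ext.{w} (cokernel (S.map' (j + 1) (j + 2))) Y (n + 1)) := by
  induction n generalizing j with
  | zero =>
    refine subsingleton_ext_one_X₃_left (shortExact_cokernel_desc (hS.exact j))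
      (fun f => ?_) hj'
    obtain ⟨g, hg⟩ := hY j (by omega) (cokernel.π (S.map' j (j + 1)) ≫ f) (by simp)
    refine ⟨g, ?_⟩
    rw [← cancel_epi (cokernel.π (S.map' j (j + 1))), ← hg]
    exact cokernel.π_desc_assoc ..
  | succ n ih =>
    obtain ⟨j, rfl⟩ : ∃ m, j = m + 1 := ⟨j - 1, by omega⟩
    exact subsingleton_ext_X₃_left (shortExact_cokernel_desc (hS.exact (j + 1)))
      (ih (fun i hi k hk => hExt i hi k (by omega)) j (by omega) (by omega)
        (hExt (j + 2) (by omega) n (by omega))) hj'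

end ExactSequences

section EssImage

open Abelian

variable {M : Type u'} [Category.{v'} M] {A : Type u} [Category.{v} A]

theorem isStableUnderRetracts_essImage [IsIdempotentComplete M] (F : M ⥤ A) [F.Full]
    [F.Faithful] : F.essImage.IsStableUnderRetracts where
  of_retract {Y Z} r hZ := by
    obtain ⟨X, ⟨e⟩⟩ := hZ
    let i : Y ⟶ F.obj X := r.i ≫ e.inv
    let p : F.obj X ⟶ Y := e.hom ≫ r.r
    have hip : i ≫ p = 𝟙 Y := by simp [i, p]
    obtain ⟨c, hc⟩ := F.map_surjective (p ≫ i)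
    obtain ⟨X', j, q, hjq, hqj⟩ := IsIdempotentComplete.idempotents_split X c
      (F.map_injective (by rw [F.map_comp, hc, Category.assoc, reassoc_of% hip]))
    replace hqj : F.map q ≫ F.map j = p ≫ i := by rw [← F.map_comp, hqj, hc]
    replace hjq : F.map j ≫ F.map q = 𝟙 _ := by rw [← F.map_comp, hjq, F.map_id]
    refine ⟨X', ⟨⟨F.map j ≫ p, i ≫ F.map q, ?_, ?_⟩⟩⟩
    · rw [Category.assoc, ← reassoc_of% hqj, hjq, Category.comp_id, hjq]
    · rw [Category.assoc, reassoc_of% hqj, hip, Category.comp_id, hip]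

theorem exists_map_iso_of_essImage (F : M ⥤ A) [F.Full] {G H : A} (f : G ⟶ H)
    (hG : F.essImage G) (hH : F.essImage H) : ∃ (X Y : M) (g : X ⟶ Y) (e : F.obj X ≅ G)
      (e' : F.obj Y ≅ H), F.map g ≫ e'.hom = e.hom ≫ f := by
  obtain ⟨X, ⟨e⟩⟩ := hG
  obtain ⟨Y, ⟨e'⟩⟩ := hH
  obtain ⟨g, hg⟩ := F.map_surjective (e.hom ≫ f ≫ e'.inv)
  exact ⟨X, Y, g, e, e', by simp [hg]⟩

variable [Preadditive M]

theorem essImage_biprod [Preadditive A] [HasBinaryBiproducts M] [HasBinaryBiproducts A] (F : M ⥤ A)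
    [F.Additive] {G H : A} (hG : F.essImage G) (hH : F.essImage H) : F.essImage (G ⊞ H) := by
  have := preservesBinaryBiproducts_of_preservesBiproducts F
  obtain ⟨X, ⟨e⟩⟩ := hG
  obtain ⟨Y, ⟨e'⟩⟩ := hH
  exact ⟨X ⊞ Y, ⟨F.mapBiprod X Y ≪≫ biprod.mapIso e e'⟩⟩

/-- `k` is a weak kernel of `f`: the morphisms killed by `f` are those that factor, not
necessarily uniquely, through `k`. -/
def IsWeakKernel {W X Y : M} (k : W ⟶ X) (f : X ⟶ Y) : Prop :=
  ∀ Z : M, Function.Exact (fun h : Z ⟶ W => h ≫ k) (fun h : Z ⟶ X => h ≫ f)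

variable {d : ℕ} {S : ComposableArrows M (d + 1)}

theorem IsWeakKernel.comp_eq_zero {W X Y : M} {k : W ⟶ X} {f : X ⟶ Y} (h : IsWeakKernel k f) :
    k ≫ f = 0 :=
  (h W k).2 ⟨𝟙 W, Category.id_comp k⟩

theorem IsDKernel.mono (hS : IsDKernel S) : Mono (S.map' 0 1) :=
  ⟨fun _ _ h => hS.injective _ h⟩

theorem IsDCokernel.epi (hS : IsDCokernel S) : Epi (S.map' d (d + 1)) :=
  ⟨fun _ _ h => hS.injective _ h⟩

variable [Abelian A] {F : M ⥤ A}

/-- `F` sends every weak kernel of a morphism to an exact sequence. -/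
def SendsWeakKernelsToExact (F : M ⥤ A) [F.PreservesZeroMorphisms] : Prop :=
  ∀ ⦃S : ShortComplex M⦄, IsWeakKernel S.f S.g → (S.map F).Exact

section

variable [F.PreservesZeroMorphisms] (hF : SendsWeakKernelsToExact F)

include hF

theorem SendsWeakKernelsToExact.preservesMonomorphisms : F.PreservesMonomorphisms where
  preserves {X Y} f _ := by
    have h : IsWeakKernel (0 : X ⟶ X) f := fun Z h =>
      ⟨fun hh => ⟨0, zero_comp.trans (zero_of_comp_mono f hh).symm⟩, by rintro ⟨t, rfl⟩; simp⟩
    exact (hF (S := .mk _ f zero_comp) h).mono_g (F.map_zero _ _)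

theorem IsDKernel.exact_map (hS : IsDKernel S) :
    ComposableArrows.Exact (S ⋙ F : ComposableArrows A (d + 1)) where
  zero i hi := by
    have h : IsWeakKernel _ _ := fun Z => hS.exact Z i (by omega)
    exact (F.map_comp _ _).symm.trans (by rw [h.comp_eq_zero, F.map_zero])
  exact i hi := by
    have h : IsWeakKernel _ _ := fun Z => hS.exact Z i (by omega)
    exact hF (S := .mk _ _ h.comp_eq_zero) h

end

theorem IsDCokernel.exists_factorization_map [F.PreservesZeroMorphisms] [F.Full] [F.Faithful]
    (hS : IsDCokernel S) {Y : A} (hY : F.essImage Y) (i : ℕ) (hi : i < d)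
    (h : F.obj (S.obj' (i + 1)) ⟶ Y) (hh : F.map (S.map' i (i + 1)) ≫ h = 0) :
    ∃ h' : F.obj (S.obj' (i + 2)) ⟶ Y, F.map (S.map' (i + 1) (i + 2)) ≫ h' = h := by
  obtain ⟨Z, ⟨e⟩⟩ := hY
  obtain ⟨g, hg⟩ := F.map_surjective (h ≫ e.inv)
  obtain ⟨g', rfl⟩ := (hS.exact Z i hi g).1
    (F.map_injective (by rw [F.map_comp, hg, reassoc_of% hh, zero_comp, F.map_zero]))
  refine ⟨F.map g' ≫ e.hom, ?_⟩
  rw [← F.map_comp_assoc, hg, Category.assoc, Iso.inv_hom_id, Category.comp_id]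

variable [F.Full] [F.Additive] (hF : SendsWeakKernelsToExact F) (hM : IsDAbelian d M)

include hF hM

theorem hasResolution_kernel_of_essImage {G H : A} (f : G ⟶ H) (hG : F.essImage G)
    (hH : F.essImage H) : HasResolution F.essImage d (kernel f) := by
  obtain ⟨X, Y, g, e, e', hg⟩ := exists_map_iso_of_essImage F f hG hH
  refine HasResolution.of_iso ?_ (kernel.mapIso _ _ e e' hg)
  obtain ⟨S, hS, hk⟩ := hM.exists_dKernel g
  cases hS
  have := hF.preservesMonomorphisms
  have := hk.mono
  have : Mono (ComposableArrows.map' (S ⋙ F : ComposableArrows A (d + 1)) 0 1) :=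
    F.map_mono _
  exact hasResolution_kernel (hk.exact_map hF) (fun _ _ => F.obj_mem_essImage _) d le_rfl

theorem hasCoresolution_cokernel_of_essImage [F.Faithful] [F.PreservesEpimorphisms]
    {G H : A} (f : G ⟶ H) [Mono f] (hG : F.essImage G) (hH : F.essImage H) :
    HasCoresolution F.essImage d (cokernel f) := by
  obtain ⟨X, Y, g, e, e', hg⟩ := exists_map_iso_of_essImage F f hG hH
  have : Mono g := F.mono_of_mono_map (by rw [← Iso.eq_comp_inv] at hg; rw [hg]; infer_instance)
  refine HasCoresolution.of_iso ?_ (cokernel.mapIso _ _ e e' hg)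
  obtain ⟨S, hS, hc⟩ := hM.exists_dCokernel g
  cases hS
  have := hc.epi
  have : Epi (ComposableArrows.map' (S ⋙ F : ComposableArrows A (d + 1)) d (d + 1)) :=
    F.map_epi _
  have hk := (hM.isDExact_of_mono S ‹_› hc).isDKernel
  exact hasCoresolution_cokernel (hk.exact_map hF) (fun _ _ => F.obj_mem_essImage _) d 0
    (zero_add d)

variable [F.Faithful] [F.PreservesEpimorphisms] [F.PreservesProjectiveObjects]

theorem subsingleton_ext_map_of_epi [HasExt.{w} A] {P X : M} (f : P ⟶ X) [Projective P] [Epi f]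
    {Y : A} (hY : F.essImage Y) {n : ℕ} (hn : n + 1 < d)
    (hExt : ∀ k, k < n → ∀ Z : M, Subsingleton (Ext.{w} (F.obj Z) Y (k + 1))) :
    Subsingleton (Ext.{w} (F.obj X) Y (n + 1)) := by
  obtain ⟨j, rfl⟩ : ∃ j, d = j + 2 := ⟨d - 2, by omega⟩
  have := F.projective_obj P
  have hP : Subsingleton (Ext.{w} (F.obj P) Y (n + 1)) := Ext.subsingleton_of_projective _ _ _
  obtain ⟨S, hS, hk⟩ := hM.exists_dKernel f
  cases hS
  have hc := (hM.isDExact_of_epi S ‹_› hk).isDCokernel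
  have hex := hk.exact_map hF
  have hcoker := hex.exact (j + 1)
  have : Epi (ComposableArrows.sc (S ⋙ F : ComposableArrows A (j + 3)) hex.toIsComplex
    (j + 1)).g := F.map_epi _
  exact subsingleton_ext_of_iso
    ((colimit.isColimit _).coconePointUniqueUpToIso hcoker.gIsCokernel)
    (subsingleton_ext_cokernel hex (hc.exists_factorization_map hY)
      (fun i hi k hkn => hExt k hkn _) j (by omega) (by omega) hP)

theorem essImage_le_leftExtOrthogonal [HasExt.{w} A] [EnoughProjectives M] :
    F.essImage ≤ leftExtOrthogonal d F.essImage := by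
  intro G ⟨X, ⟨e⟩⟩ i hi hid Y hY
  obtain ⟨n, rfl⟩ : ∃ n, i = n + 1 := ⟨i - 1, by omega⟩
  induction n using Nat.strong_induction_on generalizing X G with
  | _ n ih =>
    exact subsingleton_ext_of_iso e (subsingleton_ext_map_of_epi hF hM (Projective.π X) hY hid
      fun k hk Z => ih k hk _ Z (Iso.refl _) (by omega) (by omega))

open scoped ZeroObject in
theorem isClusterTilting_essImage (hd : 1 ≤ d) [EnoughProjectives M]
    (hpres : ∀ G : A, ∃ (X Y : M) (f : X ⟶ Y), Nonempty (cokernel (F.map f) ≅ G)) :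
    IsClusterTilting d F.essImage := by
  have := hM.hasFiniteBiproducts
  have := hM.isIdempotentComplete
  have := isStableUnderRetracts_essImage F
  have := hasBinaryBiproducts_of_finite_biproducts M
  have : F.essImage.ContainsZero :=
    ⟨F.obj 0, F.map_isZero (isZero_zero M), F.obj_mem_essImage _⟩
  refine isClusterTilting_of_le_leftExtOrthogonal (fun G H => essImage_biprod F) hd
    (have := HasExt.standard A; essImage_le_leftExtOrthogonal hF hM)
    (fun G H f => hasResolution_kernel_of_essImage hF hM f)
    (fun G H f _ => hasCoresolution_cokernel_of_essImage hF hM f) fun G => ?_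
  obtain ⟨X, Y, f, e⟩ := hpres G
  exact ⟨_, _, F.map f, F.obj_mem_essImage X, F.obj_mem_essImage Y, e⟩

end EssImage

section FunctorCategory

variable {C : Type u'} [Category.{v'} C]

theorem natTrans_mono_iff_injective_app {G H : C ⥤ AddCommGrpCat.{w}} (f : G ⟶ H) :
    Mono f ↔ ∀ X : C, Function.Injective (f.app X) := by
  simp only [NatTrans.mono_iff_mono_app, AddCommGrpCat.mono_iff_injective]

theorem natTrans_epi_iff_surjective_app {G H : C ⥤ AddCommGrpCat.{w}} (f : G ⟶ H) :
    Epi f ↔ ∀ X : C, Function.Surjective (f.app X) := by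
  simp only [NatTrans.epi_iff_epi_app, AddCommGrpCat.epi_iff_surjective]

theorem shortComplex_exact_iff_exact_app (S : ShortComplex (C ⥤ AddCommGrpCat.{w})) :
    S.Exact ↔ ∀ X : C, Function.Exact (S.f.app X) (S.g.app X) := by
  have e (X : C) : (S.map ((evaluation C AddCommGrpCat.{w}).obj X)).homology ≅
    S.homology.obj X := S.mapHomologyIso _
  have hev : S.Exact ↔ ∀ X : C, (S.map ((evaluation C AddCommGrpCat.{w}).obj X)).Exact := by
    simp only [ShortComplex.exact_iff_isZero_homology]
    exact ⟨fun h X => (h.obj X).of_iso (e X),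
      fun h => Functor.isZero _ fun X => (h X).of_iso (e X).symm⟩
  exact hev.trans (forall_congr' fun X => ShortComplex.ab_exact_iff_function_exact _)

theorem biprod_app_ext {G H : C ⥤ AddCommGrpCat.{w}} {X : C} {x y : (G ⊞ H).obj X}
    (h₁ : (biprod.fst : G ⊞ H ⟶ G).app X x = (biprod.fst : G ⊞ H ⟶ G).app X y)
    (h₂ : (biprod.snd : G ⊞ H ⟶ H).app X x = (biprod.snd : G ⊞ H ⟶ H).app X y) : x = y := by
  have htotal (z : (G ⊞ H).obj X) : (biprod.inl : G ⟶ G ⊞ H).app X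
      ((biprod.fst : G ⊞ H ⟶ G).app X z) + (biprod.inr : H ⟶ G ⊞ H).app X
      ((biprod.snd : G ⊞ H ⟶ H).app X z) = z :=
    ConcreteCategory.congr_hom (NatTrans.congr_app (biprod.total (X := G) (Y := H)) X) z
  rw [← htotal x, ← htotal y, h₁, h₂]

end FunctorCategory

section WeakKernels

variable {P : Type u'} [Category.{v'} P] {W X Y Z : P}

theorem factors_weakPullbackFst_iff (a : X ⟶ Z) (b : Y ⟶ Z) [HasWeakPullback a b] (h : W ⟶ X) :
    (∃ t, t ≫ weakPullback.fst a b = h) ↔ ∃ s, s ≫ b = h ≫ a := by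
  constructor
  · rintro ⟨t, rfl⟩
    exact ⟨t ≫ weakPullback.snd a b, by simp [weakPullback.condition]⟩
  · rintro ⟨s, hs⟩
    exact ⟨weakPullback.lift h s hs.symm, weakPullback.lift_fst _ _ _⟩

variable [Preadditive P]

theorem IsWeakKernel.hasWeakKernel {k : W ⟶ X} {f : X ⟶ Y} (hk : IsWeakKernel k f) :
    HasWeakKernel f :=
  .mk ⟨KernelFork.ofι k hk.comp_eq_zero, Fork.IsWeakLimit.mk' _ fun s =>
    Classical.indefiniteDescription _ ((hk _ s.ι).1 (KernelFork.condition s))⟩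

theorem isWeakKernel_weakKernelι (f : X ⟶ Y) [HasWeakKernel f] :
    IsWeakKernel (weakKernel.ι f) f := fun _ h =>
  ⟨fun hh => ⟨weakKernel.lift f h hh, weakKernel.lift_ι f h hh⟩, by
    rintro ⟨t, rfl⟩
    simp⟩

instance [HasWeakKernels P] [HasBinaryBiproducts P] : HasWeakPullbacks P :=
  have := Preadditive.hasWeakEqualizers_of_hasWeakKernels (C := P)
  hasWeakPullbacks_of_hasBinaryProducts_of_hasWeakEqualizers P

end WeakKernels

section FinitelyPresented

variable {P : Type u'} [Category.{v'} P] [Preadditive P]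

/-- The action of a morphism out of a representable functor on the elements of that functor. -/
def yonedaApply {X : P} {G : Pᵒᵖ ⥤ AddCommGrpCat.{v'}} (g : preadditiveYoneda.obj X ⟶ G) {Q : P} :
    (Q ⟶ X) →+ G.obj (op Q) :=
  (g.app (op Q)).hom

variable {X Y : P} {G H : Pᵒᵖ ⥤ AddCommGrpCat.{v'}}

theorem yonedaApply_map_comp (a : X ⟶ Y) (g : preadditiveYoneda.obj Y ⟶ G) {Q : P} (h : Q ⟶ X) :
    yonedaApply (preadditiveYoneda.map a ≫ g) h = yonedaApply g (h ≫ a) :=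
  rfl

theorem yonedaApply_comp (g : preadditiveYoneda.obj X ⟶ G) (f : G ⟶ H) {Q : P} (h : Q ⟶ X) :
    yonedaApply (g ≫ f) h = f.app (op Q) (yonedaApply g h) :=
  rfl

theorem map_yonedaApply (g : preadditiveYoneda.obj X ⟶ G) {Q R : P} (h : Q ⟶ X) (r : R ⟶ Q) :
    G.map r.op (yonedaApply g h) = yonedaApply g (r ≫ h) :=
  (ConcreteCategory.congr_hom (g.naturality r.op) h).symm

theorem yonedaApply_ext {g g' : preadditiveYoneda.obj X ⟶ G}
    (h : yonedaApply g (𝟙 X) = yonedaApply g' (𝟙 X)) : g = g' := by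
  have hext {Q : P} (q : Q ⟶ X) : yonedaApply g q = yonedaApply g' q := by
    rw [← Category.comp_id q, ← map_yonedaApply, ← map_yonedaApply, h]
  ext Q q
  exact hext q

theorem exists_map_comp_eq {g : preadditiveYoneda.obj Y ⟶ G}
    (hg : ∀ Q, Function.Surjective (yonedaApply g (Q := Q))) (β : preadditiveYoneda.obj X ⟶ G) :
    ∃ a : X ⟶ Y, preadditiveYoneda.map a ≫ g = β := by
  obtain ⟨a, ha⟩ := hg X (yonedaApply β (𝟙 X))
  exact ⟨a, yonedaApply_ext (by rw [yonedaApply_map_comp, Category.id_comp, ha])⟩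

/-- The sequence `P(-, P₁) ⟶ P(-, P₀) ⟶ G ⟶ 0` given by `f` and `g` is exact. -/
structure IsPresentation {P₁ P₀ : P} (f : P₁ ⟶ P₀) (g : preadditiveYoneda.obj P₀ ⟶ G) : Prop where
  surjective : ∀ Q, Function.Surjective (yonedaApply g (Q := Q))
  apply_eq_zero_iff : ∀ {Q : P} (h : Q ⟶ P₀), yonedaApply g h = 0 ↔ ∃ t, t ≫ f = h

theorem finitelyPresented_iff : finitelyPresented P G ↔
    ∃ (P₁ P₀ : P) (f : P₁ ⟶ P₀) (g : preadditiveYoneda.obj P₀ ⟶ G), IsPresentation f g :=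
  ⟨fun ⟨P₁, P₀, f, g, hg⟩ => ⟨P₁, P₀, f, g, fun Q => (hg (op Q)).2, (hg (op _)).1⟩,
    fun ⟨P₁, P₀, f, g, hg⟩ => ⟨P₁, P₀, f, g, fun Q =>
      ⟨hg.apply_eq_zero_iff, hg.surjective Q.unop⟩⟩⟩

theorem exists_yonedaApply_id_eq (hG : finitelyPresented P G) (x : G.obj (op X)) :
    ∃ g : preadditiveYoneda.obj X ⟶ G, yonedaApply g (𝟙 X) = x := by
  obtain ⟨P₁, P₀, p, g, hg⟩ := finitelyPresented_iff.1 hG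
  obtain ⟨h, rfl⟩ := hg.surjective X x
  exact ⟨preadditiveYoneda.map h ≫ g, by rw [yonedaApply_map_comp, Category.id_comp]⟩

instance : (finitelyPresented P).IsClosedUnderIsomorphisms where
  of_iso {G H} e hG := by
    obtain ⟨P₁, P₀, f, g, hg⟩ := finitelyPresented_iff.1 hG
    have hinj := (natTrans_mono_iff_injective_app e.hom).1 inferInstance
    have hsurj := (natTrans_epi_iff_surjective_app e.hom).1 inferInstance
    refine finitelyPresented_iff.2 ⟨P₁, P₀, f, g ≫ e.hom, fun Q =>
      (hsurj (op Q)).comp (hg.surjective Q), fun {Q} h => ?_⟩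
    rw [yonedaApply_comp, ← hg.apply_eq_zero_iff]
    exact map_eq_zero_iff _ (hinj (op Q))

open scoped ZeroObject in
theorem finitelyPresented_of_isZero [HasZeroObject P] (hG : IsZero G) :
    finitelyPresented P G := by
  have hG' (Q : P) (x : G.obj (op Q)) : x = 0 :=
    ConcreteCategory.congr_hom ((hG.obj (op Q)).eq_of_src (𝟙 _) 0) x
  exact finitelyPresented_iff.2 ⟨0, 0, 0, 0, fun Q x => ⟨0, (hG' Q _).trans (hG' Q _).symm⟩,
    fun {Q} h => ⟨fun _ => ⟨0, (isZero_zero P).eq_of_tgt _ _⟩, fun _ => hG' Q _⟩⟩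

theorem exists_yonedaApply_eq_zero_iff [HasWeakPullbacks P] (hG : finitelyPresented P G)
    (g : preadditiveYoneda.obj X ⟶ G) :
    ∃ (W : P) (k : W ⟶ X), ∀ {Q : P} (h : Q ⟶ X), yonedaApply g h = 0 ↔ ∃ t, t ≫ k = h := by
  obtain ⟨P₁, P₀, f, g', hf⟩ := finitelyPresented_iff.1 hG
  obtain ⟨a, rfl⟩ := exists_map_comp_eq hf.surjective g
  refine ⟨_, weakPullback.fst a f, fun h => ?_⟩
  rw [factors_weakPullbackFst_iff, yonedaApply_map_comp, hf.apply_eq_zero_iff]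

theorem finitelyPresented_kernel [HasWeakPullbacks P] (f : G ⟶ H)
    (hG : finitelyPresented P G) (hH : finitelyPresented P H) :
    finitelyPresented P (kernel f) := by
  obtain ⟨P₁, P₀, p, g, hg⟩ := finitelyPresented_iff.1 hG
  obtain ⟨W, k, hk⟩ := exists_yonedaApply_eq_zero_iff hH (g ≫ f)
  obtain ⟨V, l, hl⟩ := exists_yonedaApply_eq_zero_iff hG (preadditiveYoneda.map k ≫ g)
  have hw : (preadditiveYoneda.map k ≫ g) ≫ f = 0 :=
    yonedaApply_ext ((hk (𝟙 W ≫ k)).2 ⟨𝟙 W, rfl⟩)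
  have hinj := (natTrans_mono_iff_injective_app (kernel.ι f)).1 inferInstance
  have hι {Q : P} (t : Q ⟶ W) : (kernel.ι f).app _ (yonedaApply (kernel.lift f _ hw) t) =
      yonedaApply g (t ≫ k) := by
    rw [← yonedaApply_comp, kernel.lift_ι, yonedaApply_map_comp]
  refine finitelyPresented_iff.2 ⟨V, W, l, kernel.lift f _ hw, fun Q x => ?_, fun {Q} t => ?_⟩
  · obtain ⟨h, hh⟩ := hg.surjective Q ((kernel.ι f).app _ x)
    obtain ⟨t, rfl⟩ := (hk h).1 (by
      rw [yonedaApply_comp, hh]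
      exact ConcreteCategory.congr_hom (NatTrans.congr_app (kernel.condition f) (op Q)) x)
    exact ⟨t, hinj _ ((hι t).trans hh)⟩
  · rw [← hl, yonedaApply_map_comp, ← hι]
    exact (map_eq_zero_iff _ (hinj (op Q))).symm

variable [HasBinaryBiproducts P]

theorem IsPresentation.biprodDesc {P₁ P₀ : P} {p : P₁ ⟶ P₀} {g : preadditiveYoneda.obj P₀ ⟶ H}
    (hg : IsPresentation p g) (a : X ⟶ P₀) {π : H ⟶ G}
    (hπ : ∀ Q, Function.Surjective (π.app Q))
    (hex : ∀ Q, Function.Exact ((preadditiveYoneda.map a ≫ g).app Q) (π.app Q)) :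
    IsPresentation (biprod.desc p a) (g ≫ π) where
  surjective Q := (hπ (op Q)).comp (hg.surjective Q)
  apply_eq_zero_iff {Q} h := by
    rw [yonedaApply_comp]
    refine (hex (op Q) _).trans ⟨?_, ?_⟩
    · rintro ⟨t, ht⟩
      change Q ⟶ X at t
      replace ht : yonedaApply g (t ≫ a) = yonedaApply g h := ht
      obtain ⟨s, hs⟩ := (hg.apply_eq_zero_iff (h - t ≫ a)).1 (by rw [map_sub, ht, sub_self])
      exact ⟨biprod.lift s t, by rw [biprod.lift_desc, hs, sub_add_cancel]⟩
    · rintro ⟨t, rfl⟩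
      refine ⟨t ≫ biprod.snd, ?_⟩
      have h0 := (hg.apply_eq_zero_iff (t ≫ biprod.fst ≫ p)).2 ⟨t ≫ biprod.fst, by simp⟩
      change yonedaApply g ((t ≫ biprod.snd) ≫ a) = _
      rw [biprod.desc_eq, Preadditive.comp_add, map_add, h0, zero_add, Category.assoc]

theorem finitelyPresented_cokernel (f : G ⟶ H) (hG : finitelyPresented P G)
    (hH : finitelyPresented P H) : finitelyPresented P (cokernel f) := by
  obtain ⟨P₁, P₀, p, g, hg⟩ := finitelyPresented_iff.1 hG
  obtain ⟨Q₁, Q₀, q, g', hg'⟩ := finitelyPresented_iff.1 hH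
  obtain ⟨a, ha⟩ := exists_map_comp_eq hg'.surjective (g ≫ f)
  have hπ := (natTrans_epi_iff_surjective_app (cokernel.π f)).1 inferInstance
  have hex := (shortComplex_exact_iff_exact_app (.mk f _ (cokernel.condition f))).1
    (ShortComplex.exact_of_g_is_cokernel _ (cokernelIsCokernel f))
  refine finitelyPresented_iff.2 ⟨_, _, _, _, hg'.biprodDesc a hπ fun Q y => ?_⟩
  rw [ha]
  exact (hex Q y).trans (hg.surjective Q.unop).exists

theorem IsPresentation.biprodMap {P₁ P₀ Q₁ Q₀ : P} {p : P₁ ⟶ P₀} {q : Q₁ ⟶ Q₀}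
    {g : preadditiveYoneda.obj P₀ ⟶ G} {g' : preadditiveYoneda.obj Q₀ ⟶ H}
    (hg : IsPresentation p g) (hg' : IsPresentation q g') :
    IsPresentation (biprod.map p q) (biprod.lift (preadditiveYoneda.map biprod.fst ≫ g)
      (preadditiveYoneda.map biprod.snd ≫ g')) where
  surjective Q x := by
    obtain ⟨h, hh⟩ := hg.surjective Q ((biprod.fst : G ⊞ H ⟶ G).app _ x)
    obtain ⟨h', hh'⟩ := hg'.surjective Q ((biprod.snd : G ⊞ H ⟶ H).app _ x)
    refine ⟨biprod.lift h h', biprod_app_ext ?_ ?_⟩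
    · rw [← yonedaApply_comp, biprod.lift_fst, yonedaApply_map_comp, biprod.lift_fst, hh]
    · rw [← yonedaApply_comp, biprod.lift_snd, yonedaApply_map_comp, biprod.lift_snd, hh']
  apply_eq_zero_iff {Q} h := by
    set γ := biprod.lift (preadditiveYoneda.map biprod.fst ≫ g)
      (preadditiveYoneda.map biprod.snd ≫ g') with hγ
    have hfst : (biprod.fst : G ⊞ H ⟶ G).app _ (yonedaApply γ h) =
        yonedaApply g (h ≫ biprod.fst) := by
      rw [← yonedaApply_comp, hγ, biprod.lift_fst, yonedaApply_map_comp]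
    have hsnd : (biprod.snd : G ⊞ H ⟶ H).app _ (yonedaApply γ h) =
        yonedaApply g' (h ≫ biprod.snd) := by
      rw [← yonedaApply_comp, hγ, biprod.lift_snd, yonedaApply_map_comp]
    have hzero : yonedaApply γ h = 0 ↔
        yonedaApply g (h ≫ biprod.fst) = 0 ∧ yonedaApply g' (h ≫ biprod.snd) = 0 := by
      rw [← hfst, ← hsnd]
      exact ⟨fun h0 => by simp only [h0, map_zero, and_self],
        fun ⟨h₁, h₂⟩ => biprod_app_ext (h₁.trans (map_zero _).symm) (h₂.trans (map_zero _).symm)⟩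
    rw [hzero, hg.apply_eq_zero_iff, hg'.apply_eq_zero_iff]
    constructor
    · rintro ⟨⟨t, ht⟩, t', ht'⟩
      exact ⟨biprod.lift t t', by apply biprod.hom_ext <;> simp [ht, ht']⟩
    · rintro ⟨t, rfl⟩
      exact ⟨⟨t ≫ biprod.fst, by simp⟩, t ≫ biprod.snd, by simp⟩

theorem finitelyPresented_biprod (hG : finitelyPresented P G) (hH : finitelyPresented P H) :
    finitelyPresented P (G ⊞ H) := by
  obtain ⟨P₁, P₀, p, g, hg⟩ := finitelyPresented_iff.1 hG
  obtain ⟨Q₁, Q₀, q, g', hg'⟩ := finitelyPresented_iff.1 hH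
  exact finitelyPresented_iff.2 ⟨_, _, _, _, hg.biprodMap hg'⟩

end FinitelyPresented

section FPMod

variable {P : Type u'} [Category.{v'} P] [Preadditive P]

theorem epi_of_surjective_app {G H : FPMod P} (f : G ⟶ H)
    (hf : ∀ Q : Pᵒᵖ, Function.Surjective (f.hom.app Q)) : Epi f :=
  (finitelyPresented P).ι.epi_of_epi_map ((natTrans_epi_iff_surjective_app f.hom).2 hf)

instance [HasZeroObject P] : (finitelyPresented P).ContainsZero where
  exists_zero := ⟨_, isZero_zero _, finitelyPresented_of_isZero (isZero_zero _)⟩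

instance [HasWeakPullbacks P] : (finitelyPresented P).IsClosedUnderKernels where
  kernels_le := by
    rintro _ ⟨f, k, hk, hG, hH⟩
    exact (finitelyPresented P).prop_of_iso
      ((kernelIsKernel f).conePointUniqueUpToIso hk) (finitelyPresented_kernel f hG hH)

variable [HasBinaryBiproducts P]

instance : (finitelyPresented P).IsClosedUnderCokernels where
  cokernels_le := by
    rintro _ ⟨f, k, hk, hG, hH⟩
    exact (finitelyPresented P).prop_of_iso
      ((cokernelIsCokernel f).coconePointUniqueUpToIso hk) (finitelyPresented_cokernel f hG hH)

instance [HasZeroObject P] : (finitelyPresented P).IsClosedUnderFiniteProducts :=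
  have : (finitelyPresented P).IsClosedUnderBinaryProducts := .mk' (by
    rintro _ ⟨F, hF⟩
    exact (finitelyPresented P).prop_of_iso
      (biprod.isoProd _ _ ≪≫ (HasLimit.isoOfNatIso (diagramIsoPair F)).symm)
      (finitelyPresented_biprod (hF ⟨.left⟩) (hF ⟨.right⟩)))
  .mk'

variable [HasZeroObject P] [HasWeakKernels P]

theorem fpMod_exact_iff (S : ShortComplex (FPMod P)) :
    S.Exact ↔ ∀ Q : Pᵒᵖ, Function.Exact (S.f.hom.app Q) (S.g.hom.app Q) := by
  have : (finitelyPresented P).ι.PreservesHomology :=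
    { preservesKernels := fun _ _ f => (finitelyPresented P).preservesKernels_ι f
      preservesCokernels := fun _ _ f => (finitelyPresented P).preservesCokernels_ι f }
  exact (S.exact_map_iff_of_faithful (finitelyPresented P).ι).symm.trans
    (shortComplex_exact_iff_exact_app (S.map (finitelyPresented P).ι))

theorem surjective_app_of_epi {G H : FPMod P} (f : G ⟶ H) [Epi f] (Q : Pᵒᵖ) :
    Function.Surjective (f.hom.app Q) := by
  have hex := (fpMod_exact_iff (.mk f (0 : H ⟶ H) comp_zero)).1
    ((ShortComplex.exact_iff_epi _ rfl).2 ‹_›) Q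
  exact fun x => (hex x).1 rfl

end FPMod

section ProjectiveObjects

variable {M : Type u'} [Category.{v'} M] [Preadditive M]

open scoped ZeroObject in
instance [HasZeroObject M] : (isProjective M).ContainsZero where
  exists_zero := ⟨0, isZero_zero M, (isZero_zero M).projective⟩

instance : (isProjective M).IsClosedUnderIsomorphisms where
  of_iso e h := Projective.of_iso e h

instance [HasFiniteBiproducts M] : (isProjective M).IsClosedUnderFiniteProducts :=
  have := hasBinaryBiproducts_of_finite_biproducts M
  have : (isProjective M).IsClosedUnderBinaryProducts := .mk' (by
    rintro _ ⟨F, hF⟩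
    have : Projective (F.obj ⟨.left⟩) := hF _
    have : Projective (F.obj ⟨.right⟩) := hF _
    exact Projective.of_iso
      (biprod.isoProd _ _ ≪≫ (HasLimit.isoOfNatIso (diagramIsoPair F)).symm) inferInstance)
  .mk'

instance [HasFiniteBiproducts M] : HasFiniteBiproducts (Proj M) :=
  .of_hasFiniteProducts

variable [EnoughProjectives M]

theorem IsWeakKernel.proj {A B : Proj M} {f : A ⟶ B} {K : M} {k : K ⟶ A.obj}
    (hk : IsWeakKernel k f.hom) :
    IsWeakKernel (W := ⟨Projective.over K, Projective.projective_over K⟩)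
      (ObjectProperty.homMk (Projective.π K ≫ k)) f := by
  intro Z h
  have : Projective Z.obj := Z.property
  have h0 : h ≫ f = 0 ↔ h.hom ≫ f.hom = 0 :=
    ⟨congrArg InducedCategory.Hom.hom, ObjectProperty.hom_ext _⟩
  refine h0.trans ((hk Z.obj h.hom).trans ⟨?_, ?_⟩)
  · rintro ⟨t, ht⟩
    refine ⟨ObjectProperty.homMk (Projective.factorThru t (Projective.π K)),
      ObjectProperty.hom_ext _ ?_⟩
    exact (Projective.factorThru_comp_assoc _ _ _).trans ht
  · rintro ⟨t, rfl⟩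
    exact ⟨t.hom ≫ Projective.π K, Category.assoc _ _ _⟩

instance [HasWeakKernels M] : HasWeakKernels (Proj M) where
  hasWeakLimit f := (isWeakKernel_weakKernelι f.hom).proj.hasWeakKernel

end ProjectiveObjects

section RestrictedYoneda

variable {M : Type u'} [Category.{v'} M] [Preadditive M] {d : ℕ} (hd : 1 ≤ d)
  (hM : IsDAbelian d M)

include hd hM in
theorem IsDAbelian.hasWeakKernels : HasWeakKernels M where
  hasWeakLimit f := by
    obtain ⟨e, rfl⟩ : ∃ e, d = e + 1 := ⟨d - 1, by omega⟩
    obtain ⟨S, hS, hk⟩ := hM.exists_dKernel f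
    cases hS
    have h : IsWeakKernel (S.map' e (e + 1)) (S.map' (e + 1) (e + 2)) :=
      fun Z => hk.exact Z e (by omega)
    exact h.hasWeakKernel

include hd hM in
theorem IsDAbelian.exists_desc_of_epi {K X Y Z : M} {f : X ⟶ Y} [Epi f] {k : K ⟶ X}
    (hk : IsWeakKernel k f) (g : X ⟶ Z) (hg : k ≫ g = 0) : ∃ g' : Y ⟶ Z, f ≫ g' = g := by
  obtain ⟨e, rfl⟩ : ∃ e, d = e + 1 := ⟨d - 1, by omega⟩
  obtain ⟨S, hS, hSk⟩ := hM.exists_dKernel f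
  cases hS
  have hSc := (hM.isDExact_of_epi S ‹_› hSk).isDCokernel
  have hSw : IsWeakKernel _ _ := fun Z => hSk.exact Z e (by omega)
  obtain ⟨t, ht⟩ := (hk _ _).1 hSw.comp_eq_zero
  refine (hSc.exact Z e (by omega) g).1 ?_
  change t ≫ k = _ at ht
  change _ ≫ g = 0
  rw [← ht, Category.assoc, hg, comp_zero]

variable [EnoughProjectives M]

/-- The action of a morphism `F(X) ⟶ F(Y)` on the morphisms from a projective object to `X`. -/
def toFPModApply {X Y : M} (α : (toFPMod hd hM).obj X ⟶ (toFPMod hd hM).obj Y) {Q : Proj M} :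
    (Q.obj ⟶ X) →+ (Q.obj ⟶ Y) :=
  (α.hom.app (op Q)).hom

theorem toFPModApply_comp {X Y : M} (α : (toFPMod hd hM).obj X ⟶ (toFPMod hd hM).obj Y)
    {Q R : Proj M} (r : R ⟶ Q) (h : Q.obj ⟶ X) :
    toFPModApply hd hM α (r.hom ≫ h) = r.hom ≫ toFPModApply hd hM α h :=
  ConcreteCategory.congr_hom (α.hom.naturality r.op) h

theorem toFPMod_hom_ext {X Y : M} {α β : (toFPMod hd hM).obj X ⟶ (toFPMod hd hM).obj Y}
    (h : ∀ (Q : Proj M) (q : Q.obj ⟶ X), toFPModApply hd hM α q = toFPModApply hd hM β q) :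
    α = β := by
  apply ObjectProperty.hom_ext
  ext Q q
  exact h Q.unop q

instance : (toFPMod hd hM).Additive where
  map_add {_ _ f g} := toFPMod_hom_ext hd hM fun _ q => Preadditive.comp_add _ _ _ q f g

instance : (toFPMod hd hM).Faithful where
  map_injective {X Y f g} h := by
    let P : Proj M := ⟨Projective.over X, Projective.projective_over X⟩
    rw [← cancel_epi (Projective.π X)]
    exact congrArg (fun α => toFPModApply hd hM α (Q := P) (Projective.π X)) h

instance : (toFPMod hd hM).Full where
  map_surjective {X Y} α := by
    have := hM.hasWeakKernels hd
    let K := weakKernel (Projective.π X)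
    let P₀ : Proj M := ⟨Projective.over X, Projective.projective_over X⟩
    let P₁ : Proj M := ⟨Projective.over K, Projective.projective_over K⟩
    let r : P₁ ⟶ P₀ := ObjectProperty.homMk (Projective.π K ≫ weakKernel.ι (Projective.π X))
    have hr : r.hom ≫ Projective.π X = 0 := by
      simp only [r, ObjectProperty.homMk_hom, Category.assoc, weakKernel.condition, comp_zero]
    obtain ⟨g, hg⟩ := hM.exists_desc_of_epi hd (isWeakKernel_weakKernelι (Projective.π X))
      (toFPModApply hd hM α (Q := P₀) (Projective.π X)) (by
        rw [← cancel_epi (Projective.π K), comp_zero, ← Category.assoc]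
        exact (toFPModApply_comp hd hM α r _).symm.trans (by rw [hr, map_zero]))
    refine ⟨g, toFPMod_hom_ext hd hM fun Q q => ?_⟩
    have : Projective Q.obj := Q.property
    obtain ⟨s, rfl⟩ : ∃ s : Q ⟶ P₀, s.hom ≫ Projective.π X = q :=
      ⟨ObjectProperty.homMk (Projective.factorThru q (Projective.π X)),
        Projective.factorThru_comp _ _⟩
    calc (s.hom ≫ Projective.π X) ≫ g
      _ = s.hom ≫ toFPModApply hd hM α (Q := P₀) (Projective.π X) := by rw [Category.assoc, hg]
      _ = toFPModApply hd hM α (s.hom ≫ Projective.π X) := (toFPModApply_comp hd hM α s _).symm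

instance : (toFPMod hd hM).PreservesEpimorphisms where
  preserves {X Y} f _ := by
    have hlift (Q : M) (_ : Projective Q) (h : Q ⟶ Y) : ∃ t : Q ⟶ X, t ≫ f = h :=
      ⟨Projective.factorThru h f, Projective.factorThru_comp _ _⟩
    exact epi_of_surjective_app _ fun Q => hlift Q.unop.obj Q.unop.property

/-- On a projective object, `F` is the representable functor. -/
def restrictedYonedaIso (P : Proj M) :
    (restrictedYoneda M).obj P.obj ≅ preadditiveYoneda.obj P :=
  NatIso.ofComponents (fun Q => AddEquiv.toAddCommGrpIso
    { toFun := fun h => (ObjectProperty.homMk h : Q.unop ⟶ P)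
      invFun := fun h => (h : Q.unop ⟶ P).hom
      left_inv := fun _ => rfl
      right_inv := fun _ => rfl
      map_add' := fun _ _ => rfl }) fun _ => rfl

variable [HasZeroObject (Proj M)] [HasBinaryBiproducts (Proj M)] [HasWeakKernels (Proj M)]

instance : (toFPMod hd hM).PreservesProjectiveObjects where
  projective_obj {P} _ := ⟨fun {G H} α ε _ => by
    let Q : Proj M := ⟨P, ‹_›⟩
    let φ := restrictedYonedaIso Q
    obtain ⟨x, hx⟩ := surjective_app_of_epi ε (op Q) (yonedaApply (φ.inv ≫ α.hom) (𝟙 Q))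
    obtain ⟨g, rfl⟩ := exists_yonedaApply_id_eq G.property x
    have hg : g ≫ ε.hom = φ.inv ≫ α.hom := yonedaApply_ext hx
    refine ⟨ObjectProperty.homMk (φ.hom ≫ g), ObjectProperty.hom_ext _ ?_⟩
    exact (Category.assoc _ _ _).trans ((φ.eq_inv_comp).1 hg)⟩

theorem sendsWeakKernelsToExact_toFPMod : SendsWeakKernelsToExact (toFPMod hd hM) :=
  fun _ h => (fpMod_exact_iff _).2 fun Q => h Q.unop.obj

theorem exists_cokernel_map_toFPMod_iso (G : FPMod (Proj M)) : ∃ (X Y : M) (f : X ⟶ Y),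
    Nonempty (cokernel ((toFPMod hd hM).map f) ≅ G) := by
  obtain ⟨P₁, P₀, f, g, hg⟩ := G.property
  let p : (toFPMod hd hM).obj P₀.obj ⟶ G :=
    ObjectProperty.homMk ((restrictedYonedaIso P₀).hom ≫ g)
  have : Epi p := epi_of_surjective_app _ fun Q x => by
    obtain ⟨h, hh⟩ := (hg Q).2 x
    exact ⟨(h : Q.unop ⟶ P₀).hom, hh⟩
  have hex (Q) : Function.Exact (((toFPMod hd hM).map f.hom).hom.app Q) (p.hom.app Q) :=
    fun h => ((hg Q).1 (ObjectProperty.homMk h : Q.unop ⟶ P₀)).trans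
      ⟨fun ⟨t, ht⟩ => ⟨(t : Q.unop ⟶ P₁).hom, congrArg InducedCategory.Hom.hom ht⟩,
        fun ⟨t, ht⟩ => ⟨(ObjectProperty.homMk t : Q.unop ⟶ P₁), ObjectProperty.hom_ext _ ht⟩⟩
  have hzero : (toFPMod hd hM).map f.hom ≫ p = 0 := by
    apply ObjectProperty.hom_ext
    ext Q x
    exact (hex Q).apply_apply_eq_zero x
  have hS : (ShortComplex.mk _ p hzero).Exact := (fpMod_exact_iff _).2 hex
  exact ⟨_, _, f.hom, ⟨(cokernelIsCokernel _).coconePointUniqueUpToIso hS.gIsCokernel⟩⟩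

end RestrictedYoneda

end HigherAbelian

open HigherAbelian in
/-- Let `M` be a small projectively generated `d`-abelian category with category of projective
objects `P`, and let `F : M ⥤ mod P` be `F(X) = M(-, X)|_P`. Then `mod P`, with its pointwise
addition of morphisms, is abelian, and the essential image of `F` is `d`-cluster tilting in
`mod P`. -/
theorem theorem1p1 {M : Type u} [Category.{v} M] [Preadditive M] (d : ℕ) (hd : 1 ≤ d)
    (hM : IsDAbelian d M) [EnoughProjectives M] :
    ∃ hA : Abelian (FPMod (Proj M)),
      hA.toPreadditive = (inferInstance : Preadditive (FPMod (Proj M))) ∧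
      IsClusterTilting d (toFPMod hd hM).essImage := by
  have := hM.hasFiniteBiproducts
  have := hM.hasWeakKernels hd
  have := hasBinaryBiproducts_of_finite_biproducts (Proj M)
  refine ⟨inferInstance, rfl, ?_⟩
  exact isClusterTilting_essImage (sendsWeakKernelsToExact_toFPMod hd hM) hM hd
    (exists_cokernel_map_toFPMod_iso hd hM)
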